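/- Let $K\ge 1$ and let $\nu=(\nu_1,\dots,\nu_K)$ be a stochastic bandit problem: each $\nu_a$ is a probability distribution on $\mathbb{R}$ with expectation $\mu_a$. Assume that each $\nu_a$ is sub-Gaussian in the sense that $$\int_{\mathbb{R}} e^{\lambda (y-\mu_a)}\,\mathrm{d}\nu_a(y)\le e^{\lambda^2/2}\qquad\text{for all }\lambda\in\mathbb{R}.$$ Put $\mu^\star=\max_a\mu_a$ and $\Delta_a=\mu^\star-\mu_a$. At each round $t\ge 1$ the player picks an arm $A_t$, based on the past rewards and on auxiliary randomization (i.i.d. uniform variables on $[0,1]$), and receives a reward $Y_t$ which, conditionally on the past, is drawn according to $\nu_{A_t}$. The expected regret at horizon $T$ is $R_{\nu,T}=T\mu^\star-\mathbb{E}_\nu\bigl[\sum_{t=1}^T Y_t\bigr]$. Let $N_a(t)=\sum_{s=1}^t \mathbb{1}_{\{A_s=a\}}$ and, when $N_a(t)\ge 1$, $\widehat{\mu}_{a,t}=\frac{1}{N_a(t)}\sum_{s=1}^t Y_s\mathbb{1}_{\{A_s=a\}}$. Consider the following algorithm, which knows $\mu^\star$ but nothing else about $\nu$. In rounds $t=1,\dots,K$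 it plays arm $t$. Afterwards, at the beginning of a round $t\ge K+1$ at which no pass of type (ii) below is in progress, it forms the set of candidate arms $$\mathcal{C}_t=\Bigl\{a\in\{1,\dots,K\}:\ \widehat{\mu}_{a,t-1}-\mu^\star>-\sqrt{\tfrac{4\ln N_a(t-1)}{N_a(t-1)}}\Bigr\}.$$ (i) If $\mathcal{C}_t\ne\emptyset$, it plays an arm $A_t$ drawn at random in $\mathcal{C}_t$ by means of fresh auxiliary randomization (uniformly, or according to any other distribution on $\mathcal{C}_t$ that is a fixed function of $\mathcal{C}_t$), and goes on to round $t+1$. (ii) If $\mathcal{C}_t=\emptyset$, it plays each arm once, $A_t=1,\ A_{t+1}=2,\ \dots,\ A_{t+K-1}=K$, and goes on to round $t+K$. Then, for every such bandit problem $\nu$, the regret of this algorithm is bounded, uniformly over all horizons $T\ge 0$, by $$R_{\nu,T}\le\sum_{a:\,\Delta_a>0}\Bigl(\frac{36\ln(17/\Delta_a)}{\Delta_a}+3\Delta_a\Bigr).$$ -/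

import Mathlib

open MeasureTheory ProbabilityTheory Finset

namespace Bandit

/-! ### Stochastic bandits: strategies, the law of the game, regret -/

/-- What is revealed at a time `t`: the pair `(Y_t, U_t)` of a reward and an auxiliary
randomization. At time `0` there is no reward; `Y_0` is a dummy, deterministically `0`. -/
abbrev Obs : Type := ℝ × unitInterval

/-- The information `I_t = (U_0, Y_1, U_1, …, Y_t, U_t)`. -/
abbrev Info (t : ℕ) : Type := (Finset.Iic t) → Obs

/-- A (randomized) strategy for `K` arms: measurable maps `ψ_t`, where `A_{t+1} = ψ_t(I_t)`. -/
structure Strategy (K : ℕ) where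
  arm : (t : ℕ) → Info t → Fin K
  measurable_arm : ∀ t, Measurable (arm t)

section Game

variable {K : ℕ}

/-- The conditional law of `(Y_{t+1}, U_{t+1})` given `I_t`, i.e. `ν_{ψ_t(I_t)} ⊗ λ`, where `λ` is
the uniform law on `[0,1]`. -/
noncomputable def stepKernel (ψ : Strategy K) (ν : Fin K → Measure ℝ) (t : ℕ) :
    Kernel (Info t) Obs :=
  ((Kernel.ofFunOfCountable ν).comap (ψ.arm t) (ψ.measurable_arm t)) ×ₖ
    (Kernel.const (Info t) (volume : Measure unitInterval))

instance isMarkovKernel_stepKernel (ψ : Strategy K) (ν : Fin K → Measure ℝ)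
    [∀ a, IsProbabilityMeasure (ν a)] (t : ℕ) : IsMarkovKernel (stepKernel ψ ν t) := by
  have : IsMarkovKernel (Kernel.ofFunOfCountable ν) :=
    ⟨fun a => inferInstanceAs (IsProbabilityMeasure (ν a))⟩
  unfold stepKernel
  infer_instance

/-- The law `P_ν` of the whole game `(U_0, Y_1, U_1, Y_2, U_2, …)` when the strategy `ψ` plays
against the bandit problem `ν` (Ionescu-Tulcea construction). -/
noncomputable def law (ψ : Strategy K) (ν : Fin K → Measure ℝ)
    [∀ a, IsProbabilityMeasure (ν a)] : Measure (ℕ → Obs) :=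
  Kernel.trajMeasure (X := fun _ => Obs)
    ((Measure.dirac (0 : ℝ)).prod (volume : Measure unitInterval)) (stepKernel ψ ν)

/-- The expected payoff `μ_a` of arm `a`. -/
noncomputable def armMean (ν : Fin K → Measure ℝ) (a : Fin K) : ℝ := ∫ y, y ∂(ν a)

/-- The largest expected payoff `μ⋆`. -/
noncomputable def bestMean [NeZero K] (ν : Fin K → Measure ℝ) : ℝ :=
  Finset.univ.sup' Finset.univ_nonempty (armMean ν)

/-- The gap `Δ_a = μ⋆ - μ_a`. -/
noncomputable def gap [NeZero K] (ν : Fin K → Measure ℝ) (a : Fin K) : ℝ :=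
  bestMean ν - armMean ν a

/-- The expected regret `R_{ν,T} = T μ⋆ - E_ν[Y_1 + ⋯ + Y_T]`. -/
noncomputable def regret [NeZero K] (ψ : Strategy K) (ν : Fin K → Measure ℝ)
    [∀ a, IsProbabilityMeasure (ν a)] (T : ℕ) : ℝ :=
  T * bestMean ν - ∫ ω, ∑ t ∈ Finset.Icc 1 T, (ω t).1 ∂(law ψ ν)

/-- Every arm is sub-Gaussian around its mean, with variance parameter `1`:
`∫ exp (x (y - μ_a)) dν_a(y) ≤ exp (x² / 2)` for all real `x`, the integrals being finite. -/
def IsSubGaussian (ν : Fin K → Measure ℝ) : Prop :=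
  ∀ a, HasSubgaussianMGF (fun y => y - armMean ν a) 1 (ν a)

end Game

/-! ### The algorithm for known `μ⋆` -/

section Algorithm

variable {K : ℕ}

/-- A way of drawing an arm at random in a set `C` of candidates by means of a uniform variable
`u`; the law of the draw may be any law on `C`. -/
structure SelectionRule (K : ℕ) where
  pick : Finset (Fin K) → unitInterval → Fin K
  measurable_pick : ∀ C, Measurable (pick C)
  pick_mem : ∀ C : Finset (Fin K), C.Nonempty → ∀ u, pick C u ∈ C

/-- The uniform draw: the element of `C` of rank `⌊u |C|⌋` (the last one if `u = 1`). -/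
noncomputable def uniformSelection (K : ℕ) [NeZero K] : SelectionRule K where
  pick C u := if hC : C.Nonempty then
      C.orderEmbOfFin rfl ⟨min ⌊(u : ℝ) * (C.card : ℝ)⌋₊ (C.card - 1), by
        have := hC.card_pos
        omega⟩
    else 0
  measurable_pick C := by
    by_cases hC : C.Nonempty
    · simp only [hC, dif_pos]
      refine (measurable_of_countable (C.orderEmbOfFin rfl)).comp ?_
      have hm : Measurable fun u : unitInterval =>
          min ⌊(u : ℝ) * (C.card : ℝ)⌋₊ (C.card - 1) :=
        ((Nat.measurable_floor.comp (measurable_subtype_coe.mul_const _))).min measurable_const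
      refine measurable_to_countable' fun k => ?_
      convert hm (measurableSet_singleton (k : ℕ)) using 1
      ext u
      simp [Fin.ext_iff]
    · simp only [hC, dif_neg, not_false_eq_true]
      exact measurable_const
  pick_mem C hC u := by
    simp only [hC, dif_pos]
    exact Finset.orderEmbOfFin_mem C rfl _

/-- The memory of the algorithm after some round `t`. If `next < K`, a round-robin pass over the
arms is in progress (the initial one, or a later one) and arm number `next`, counted from `0`, is
to be played at round `t + 1`; if `next = K`, no pass is in progress. -/
structure Memory (K : ℕ) where
  /-- position in the current round-robin pass -/
  next : ℕ
  /-- `N_a(t)`, the number of times arm `a` has been played -/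
  pulls : Fin K → ℕ
  /-- the sum of the rewards obtained when playing arm `a` -/
  total : Fin K → ℝ

/-- At the start, no arm has been played, and a first round-robin pass is to be made. -/
def initialMemory (K : ℕ) : Memory K := ⟨0, fun _ => 0, fun _ => 0⟩

/-- The empirical mean of arm `a` (used only once `a` has been played). -/
noncomputable def empMean (s : Memory K) (a : Fin K) : ℝ := s.total a / s.pulls a

open Classical in
/-- The set of candidate arms. The parameter `m` is the known value of `μ⋆`. -/
noncomputable def candidates (m : ℝ) (s : Memory K) : Finset (Fin K) :=
  Finset.univ.filter fun a =>
    empMean s a - m > -Real.sqrt (4 * Real.log (s.pulls a) / s.pulls a)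

open Classical in
/-- The arm played next: the next one of the round-robin pass in progress, if any; otherwise a
random candidate if there are candidates, and the first arm if there are none. -/
noncomputable def chooseArm [NeZero K] (m : ℝ) (σ : SelectionRule K) (s : Memory K)
    (u : unitInterval) : Fin K :=
  if h : s.next < K then ⟨s.next, h⟩
  else if (candidates m s).Nonempty then σ.pick (candidates m s) u
  else 0

open Classical in
/-- The position after the next round: a pass in progress is continued up to its end; otherwise,
when there is no candidate, a new pass starts, and its first arm has just been played. -/
noncomputable def nextPosition (m : ℝ) (s : Memory K) : ℕ :=
  if s.next < K then s.next + 1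
  else if (candidates m s).Nonempty then K
  else 1

/-- Update of the memory in a round with auxiliary randomization `u` and reward `y`. -/
noncomputable def updateMemory [NeZero K] (m : ℝ) (σ : SelectionRule K) (s : Memory K)
    (u : unitInterval) (y : ℝ) : Memory K where
  next := nextPosition m s
  pulls a := s.pulls a + if chooseArm m σ s u = a then 1 else 0
  total a := s.total a + if chooseArm m σ s u = a then y else 0

/-- The memory after `t` rounds; it depends on `U_0, Y_1, U_1, …, U_{t-1}, Y_t` only. -/
noncomputable def memory [NeZero K] (m : ℝ) (σ : SelectionRule K) (ω : ℕ → Obs) : ℕ → Memory K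
  | 0 => initialMemory K
  | t + 1 => updateMemory m σ (memory m σ ω t) (ω t).2 (ω (t + 1)).1

/-- A finite information vector, continued arbitrarily (by its last entry) to a full sequence. -/
def extend {t : ℕ} (h : Info t) (n : ℕ) : Obs :=
  h ⟨min n t, Finset.mem_Iic.2 (min_le_right n t)⟩

lemma measurableSet_candidates_eq {α : Type*} [MeasurableSpace α] (m : ℝ) (s : α → Memory K)
    (hp : ∀ a, Measurable fun x => (s x).pulls a) (ht : ∀ a, Measurable fun x => (s x).total a)
    (C : Finset (Fin K)) : MeasurableSet {x | candidates m (s x) = C} := by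
  have hc : ∀ a, Measurable fun x => ((s x).pulls a : ℝ) := fun a =>
    (measurable_of_countable (fun n : ℕ => (n : ℝ))).comp (hp a)
  have hmem : ∀ a, MeasurableSet {x | a ∈ candidates m (s x)} := by
    intro a
    have key : MeasurableSet {x |
        -Real.sqrt (4 * Real.log ((s x).pulls a) / (s x).pulls a) < empMean (s x) a - m} :=
      measurableSet_lt (((hc a).log.const_mul 4).div (hc a)).sqrt.neg
        (((ht a).div (hc a)).sub_const m)
    convert key using 2
    ext x
    simp [candidates]
  have : {x | candidates m (s x) = C} =
      ⋂ a, {x | a ∈ candidates m (s x) ↔ a ∈ C} := by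
    ext x
    simp [Finset.ext_iff]
  rw [this]
  refine MeasurableSet.iInter fun a => ?_
  by_cases ha : a ∈ C
  · simp only [ha, iff_true]
    exact hmem a
  · simp only [ha, iff_false]
    exact (hmem a).compl

/-- A function of the position and of the candidate set is measurable. -/
lemma measurable_of_candidates {α β : Type*} [MeasurableSpace α] [MeasurableSpace β] (m : ℝ)
    (s : α → Memory K) (hn : Measurable fun x => (s x).next)
    (hp : ∀ a, Measurable fun x => (s x).pulls a) (ht : ∀ a, Measurable fun x => (s x).total a)
    (f : ℕ → Finset (Fin K) → α → β) (hf : ∀ n C, Measurable (f n C)) :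
    Measurable fun x => f (s x).next (candidates m (s x)) x := by
  intro B hB
  have : (fun x => f (s x).next (candidates m (s x)) x) ⁻¹' B =
      ⋃ n, ⋃ C, ({x | (s x).next = n} ∩ {x | candidates m (s x) = C}) ∩ f n C ⁻¹' B := by
    ext x
    simp
  rw [this]
  exact MeasurableSet.iUnion fun n => MeasurableSet.iUnion fun C =>
    ((hn (measurableSet_singleton n)).inter (measurableSet_candidates_eq m s hp ht C)).inter
      (hf n C hB)

lemma measurable_chooseArm [NeZero K] {α : Type*} [MeasurableSpace α] (m : ℝ)
    (σ : SelectionRule K) (s : α → Memory K) (u : α → unitInterval)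
    (hn : Measurable fun x => (s x).next)
    (hp : ∀ a, Measurable fun x => (s x).pulls a) (ht : ∀ a, Measurable fun x => (s x).total a)
    (hu : Measurable u) : Measurable fun x => chooseArm m σ (s x) (u x) := by
  classical
  refine measurable_of_candidates m s hn hp ht
    (fun n C x => if h : n < K then (⟨n, h⟩ : Fin K)
      else if C.Nonempty then σ.pick C (u x) else 0) fun n C => ?_
  by_cases h : n < K
  · simp only [h, dif_pos]
    exact measurable_const
  · by_cases hC : C.Nonempty
    · simp only [h, hC, dif_neg, if_pos, not_false_eq_true]
      exact (σ.measurable_pick C).comp hu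
    · simp only [h, hC, dif_neg, if_neg, not_false_eq_true]
      exact measurable_const

lemma measurable_memory [NeZero K] {α : Type*} [MeasurableSpace α] (m : ℝ) (σ : SelectionRule K)
    (ω : α → ℕ → Obs) (hω : ∀ n, Measurable fun x => ω x n) (t : ℕ) :
    (Measurable fun x => (memory m σ (ω x) t).next) ∧
    (∀ a, Measurable fun x => (memory m σ (ω x) t).pulls a) ∧
    (∀ a, Measurable fun x => (memory m σ (ω x) t).total a) := by
  classical
  induction t with
  | zero => exact ⟨measurable_const, fun _ => measurable_const, fun _ => measurable_const⟩
  | succ t ih =>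
    obtain ⟨hn, hp, ht⟩ := ih
    have hA := measurable_chooseArm m σ _ _ hn hp ht (hω t).snd
    refine ⟨?_, fun a => ?_, fun a => ?_⟩
    · exact measurable_of_candidates m _ hn hp ht
        (fun n C _ => if n < K then n + 1 else if C.Nonempty then K else 1)
        fun n C => measurable_const
    · exact (hp a).add (Measurable.ite (hA (measurableSet_singleton a)) measurable_const
        measurable_const)
    · exact (ht a).add (Measurable.ite (hA (measurableSet_singleton a)) (hω (t + 1)).fst
        measurable_const)

/-- The algorithm, as a strategy. It knows the number `m` (meant to be `μ⋆`) and the past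
information, and nothing else about the bandit problem. -/
noncomputable def knownBestMeanStrategy [NeZero K] (m : ℝ) (σ : SelectionRule K) :
    Strategy K where
  arm t h := chooseArm m σ (memory m σ (extend h) t) (extend h t).2
  measurable_arm t := by
    have hext : ∀ n, Measurable fun h : Info t => extend h n := fun n => measurable_pi_apply _
    obtain ⟨hn, hp, ht⟩ := measurable_memory m σ (fun h : Info t => extend h) hext t
    exact measurable_chooseArm m σ _ _ hn hp ht (hext t).snd

end Algorithm

end Bandit

/-!
The regret is `∑ a, Δ_a * E[N_a(T)]` (`Bandit.regret_eq_sum_gap`, `Bandit.sum_gap_playedArm`), so it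
suffices to show that an arm `a` with gap `d > 0` satisfies `E[N_a(T)] ≤ 36 ln(17/d) / d² + 3`
(`Bandit.integral_pulls_le`). Let `b` be an optimal arm.

Along every trajectory (`Bandit.pulls_le_of_weights`), `N_a(T)` is at most `1`, for the initial pass,
plus the number of `n ≥ 1` such that `b` fails to be a candidate after `n` plays of `b`, plus the
number of `n ≥ 1` such that `a` is a candidate after `n` plays of `a`. Indeed a later pass starts
only when `b` is not a candidate, and `b` is played during the pass, so that different passes
correspond to different `n`.

For a fixed `n`, the first `n` rewards of an arm, although collected at random times, satisfy
Chernoff bounds: the product of `exp (x (Y - μ) - x² / 2)` over those collected so far has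
expectation at most `1` (`Bandit.lintegral_exp_expMartExponent_le`), and it is constant after the
`n`-th play (`Bandit.expMartExponent_eq`). Taking `x = -√(4 ln n / n)` for `b`, the first event
has probability at most `n⁻²`, and `∑ n⁻² = π² / 6 < 1.7`. For `a`, take `x = d / 2`: as soon as
`√(4 ln n / n) ≤ d / 2`, which holds for `n` beyond `Bandit.burnIn d`, the second event has
probability at most `exp (-n d² / 8)`, and these terms add up to at most `8 / d²`. The sum of all
these contributions is at most the announced value (`Bandit.burnIn_add_tail_le`).
-/

namespace Bandit

/-! ### One round of the game -/

lemma lintegral_exp_increment_le {K : ℕ} {ν : Fin K → Measure ℝ} (hν : IsSubGaussian ν) (a : Fin K)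
    (x : ℝ) :
    ∫⁻ y, ENNReal.ofReal (Real.exp (x * (y - armMean ν a) - x ^ 2 / 2)) ∂(ν a) ≤ 1 := by
  have h : ∀ y, Real.exp (x * (y - armMean ν a) - x ^ 2 / 2) =
      Real.exp (x * (y - armMean ν a)) * Real.exp (- (x ^ 2 / 2)) := fun y => by
    rw [← Real.exp_add]; ring_nf
  rw [← ofReal_integral_eq_lintegral_ofReal]
  · rw [← ENNReal.ofReal_one]
    refine ENNReal.ofReal_le_ofReal ?_
    simp only [h]
    rw [integral_mul_const]
    have := (hν a).mgf_le x
    simp only [mgf, NNReal.coe_one, one_mul] at this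
    calc _ ≤ Real.exp (x ^ 2 / 2) * Real.exp (-(x ^ 2 / 2)) := by gcongr
      _ = 1 := by rw [← Real.exp_add]; simp
  · simp only [h]
    exact ((hν a).integrable_exp_mul x).mul_const _
  · exact .of_forall fun y => (Real.exp_pos _).le

section Game

variable {K : ℕ} (ψ : Strategy K) (ν : Fin K → Measure ℝ) [∀ a, IsProbabilityMeasure (ν a)]

instance isProbabilityMeasure_law : IsProbabilityMeasure (law ψ ν) := by
  unfold law
  infer_instance

lemma stepKernel_apply (t : ℕ) (h : Info t) :
    stepKernel ψ ν t h = (ν (ψ.arm t h)).prod (volume : Measure unitInterval) := by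
  have : IsMarkovKernel (Kernel.ofFunOfCountable ν) :=
    ⟨fun a => inferInstanceAs (IsProbabilityMeasure (ν a))⟩
  unfold stepKernel
  rw [Kernel.prod_apply]
  rfl

/-- The joint law of the information `I_t` and of the next observation. -/
lemma map_law_succ (t : ℕ) :
    (law ψ ν).map (fun ω => (Preorder.frestrictLe (π := fun _ => Obs) t ω, ω (t + 1))) =
      (law ψ ν).map (Preorder.frestrictLe (π := fun _ => Obs) t) ⊗ₘ stepKernel ψ ν t :=
  (Kernel.map_frestrictLe_trajMeasure_compProd_eq_map_trajMeasure (X := fun _ => Obs)).symm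

/-- Given the information `I_t`, the reward `Y_{t+1}` is drawn according to `ν_{A_{t+1}}`. -/
lemma lintegral_law_succ (t : ℕ) {g : Info t → ℝ → ENNReal}
    (hg : Measurable (Function.uncurry g)) :
    ∫⁻ ω, g (Preorder.frestrictLe (π := fun _ => Obs) t ω) (ω (t + 1)).1 ∂(law ψ ν) =
      ∫⁻ ω, ∫⁻ y, g (Preorder.frestrictLe (π := fun _ => Obs) t ω) y
        ∂(ν (ψ.arm t (Preorder.frestrictLe (π := fun _ => Obs) t ω))) ∂(law ψ ν) := by
  have hg' : Measurable fun p : Info t × Obs => g p.1 p.2.1 :=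
    hg.comp (measurable_fst.prodMk measurable_snd.fst)
  have hm : Measurable fun ω : ℕ → Obs =>
      (Preorder.frestrictLe (π := fun _ => Obs) t ω, ω (t + 1)) := by fun_prop
  have h1 := lintegral_map (μ := law ψ ν) hg' hm
  rw [map_law_succ, Measure.lintegral_compProd hg', lintegral_map
    hg'.lintegral_kernel_prod_right' (by fun_prop)] at h1
  rw [← h1]
  refine lintegral_congr fun ω => ?_
  rw [stepKernel_apply]
  have h2 : Measurable fun p : Obs =>
      g (Preorder.frestrictLe (π := fun _ => Obs) t ω) p.1 :=
    hg'.comp measurable_prodMk_left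
  rw [lintegral_prod _ h2.aemeasurable]
  simp

variable {ψ ν}

lemma integrable_reward (hν : IsSubGaussian ν) (t : ℕ) :
    Integrable (fun ω : ℕ → Obs => (ω (t + 1)).1) (law ψ ν) := by
  have hid : ∀ a, Integrable (fun y : ℝ => y) (ν a) := fun a => by
    refine ((hν a).integrable.add (integrable_const (armMean ν a))).congr (.of_forall fun y => ?_)
    simp
  refine ⟨(measurable_pi_apply (t + 1)).fst.aestronglyMeasurable, ?_⟩
  have hstep := lintegral_law_succ ψ ν t (g := fun _ y => ‖y‖ₑ) (by fun_prop)
  unfold HasFiniteIntegral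
  rw [hstep]
  calc _ ≤ ∫⁻ _ω, ∑ a, ∫⁻ y, ‖y‖ₑ ∂(ν a) ∂(law ψ ν) :=
        lintegral_mono fun ω =>
          Finset.single_le_sum (f := fun a => ∫⁻ y, ‖y‖ₑ ∂(ν a)) (fun _ _ => zero_le)
            (Finset.mem_univ _)
    _ < ⊤ := by
        simpa using fun a => hasFiniteIntegral_iff_enorm.1 (hid a).2

lemma integral_reward (hν : IsSubGaussian ν) (t : ℕ) :
    ∫ ω, (ω (t + 1)).1 ∂(law ψ ν) =
      ∫ ω, armMean ν (ψ.arm t (Preorder.frestrictLe (π := fun _ => Obs) t ω)) ∂(law ψ ν) := by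
  have hm : Measurable fun ω : ℕ → Obs =>
      (Preorder.frestrictLe (π := fun _ => Obs) t ω, ω (t + 1)) := by fun_prop
  have hf : Measurable fun p : Info t × Obs => p.2.1 := by fun_prop
  have h1 := integral_map (μ := law ψ ν) hm.aemeasurable hf.aestronglyMeasurable
  have hi : Integrable (fun p : Info t × Obs => p.2.1)
      ((law ψ ν).map (Preorder.frestrictLe (π := fun _ => Obs) t) ⊗ₘ stepKernel ψ ν t) := by
    rw [← map_law_succ, integrable_map_measure hf.aestronglyMeasurable hm.aemeasurable]
    exact integrable_reward hν t
  have hk : ∀ h : Info t, ∫ p : Obs, p.1 ∂(stepKernel ψ ν t h) = armMean ν (ψ.arm t h) := by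
    intro h
    rw [stepKernel_apply, integral_fun_fst (fun y : ℝ => y)]
    simp [armMean]
  rw [map_law_succ, Measure.integral_compProd hi] at h1
  simp only [hk] at h1
  rw [← h1]
  refine integral_map (by fun_prop) (Measurable.aestronglyMeasurable ?_)
  exact (measurable_of_countable (armMean ν)).comp (ψ.measurable_arm t)

/-- The regret is the expected sum of the gaps of the arms played. -/
lemma regret_eq_sum_gap [NeZero K] (hν : IsSubGaussian ν) (T : ℕ) :
    regret ψ ν T = ∑ t ∈ range T,
      ∫ ω, gap ν (ψ.arm t (Preorder.frestrictLe (π := fun _ => Obs) t ω)) ∂(law ψ ν) := by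
  have hA : ∀ t, Integrable (fun ω : ℕ → Obs =>
      armMean ν (ψ.arm t (Preorder.frestrictLe (π := fun _ => Obs) t ω))) (law ψ ν) := by
    intro t
    obtain ⟨C, hC⟩ := (Set.finite_range (armMean ν)).isBounded.exists_norm_le
    refine Integrable.of_bound (C := C) (Measurable.aestronglyMeasurable ?_)
      (.of_forall fun ω => hC _ ⟨_, rfl⟩)
    exact (measurable_of_countable (armMean ν)).comp
      ((ψ.measurable_arm t).comp (by fun_prop))
  have hsum : ∀ ω : ℕ → Obs, ∑ t ∈ Finset.Icc 1 T, (ω t).1 = ∑ t ∈ range T, (ω (t + 1)).1 := by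
    intro ω
    rw [Finset.range_eq_Ico, Finset.sum_Ico_add' (fun t => (ω t).1) 0 T 1]
    rfl
  unfold regret gap
  simp only [hsum]
  rw [integral_finsetSum _ fun t _ => integrable_reward hν t]
  simp only [integral_reward hν]
  simp_rw [integral_sub (integrable_const _) (hA _)]
  simp

end Game

/-! ### Concentration of the rewards of one arm -/

section Concentration

variable {K : ℕ} [NeZero K] (m : ℝ) (σ : SelectionRule K)

/-- The arm `A_{t+1}` played by the algorithm at round `t + 1`. -/
noncomputable def playedArm (ω : ℕ → Obs) (t : ℕ) : Fin K :=
  chooseArm m σ (memory m σ ω t) (ω t).2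

lemma memory_congr {ω ω' : ℕ → Obs} {t : ℕ} (h : ∀ i ≤ t, ω i = ω' i) :
    memory m σ ω t = memory m σ ω' t := by
  induction t with
  | zero => rfl
  | succ t ih =>
    rw [memory, memory, ih fun i hi => h i (by omega), h t (by omega), h (t + 1) le_rfl]

lemma extend_frestrictLe (ω : ℕ → Obs) (t i : ℕ) (hi : i ≤ t) :
    extend (Preorder.frestrictLe (π := fun _ => Obs) t ω) i = ω i := by
  simp [extend, hi]

lemma playedArm_congr {ω ω' : ℕ → Obs} {t : ℕ} (h : ∀ i ≤ t, ω i = ω' i) :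
    playedArm m σ ω t = playedArm m σ ω' t := by
  rw [playedArm, playedArm, memory_congr m σ h, h t le_rfl]

lemma knownBestMeanStrategy_arm (ω : ℕ → Obs) (t : ℕ) :
    (knownBestMeanStrategy m σ).arm t (Preorder.frestrictLe (π := fun _ => Obs) t ω) =
      playedArm m σ ω t :=
  playedArm_congr m σ (extend_frestrictLe ω t)

lemma measurable_playedArm (t : ℕ) : Measurable fun ω : ℕ → Obs => playedArm m σ ω t := by
  obtain ⟨hn, hp, ht⟩ := measurable_memory m σ (fun ω : ℕ → Obs => ω) measurable_pi_apply t
  exact measurable_chooseArm m σ _ _ hn hp ht (measurable_pi_apply t).snd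

/-- The exponent after `t` rounds of the exponential supermartingale attached to the first `n`
plays of arm `a`: the sum of `x (Y - c) - x² / 2` over the rewards `Y` of these plays that have
been obtained so far. It does not change any more once `a` has been played `n` times, so that it
keeps the value it had at the random time of the `n`-th play. -/
noncomputable def expMartExponent (a : Fin K) (n : ℕ) (x c : ℝ) (ω : ℕ → Obs) : ℕ → ℝ
  | 0 => 0
  | t + 1 => expMartExponent a n x c ω t +
      if playedArm m σ ω t = a ∧ (memory m σ ω t).pulls a < n
      then x * ((ω (t + 1)).1 - c) - x ^ 2 / 2 else 0

variable (a : Fin K) (n : ℕ) (x c : ℝ)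

lemma expMartExponent_congr {ω ω' : ℕ → Obs} {t : ℕ} (h : ∀ i ≤ t, ω i = ω' i) :
    expMartExponent m σ a n x c ω t = expMartExponent m σ a n x c ω' t := by
  induction t with
  | zero => rfl
  | succ t ih =>
    have h' : ∀ i ≤ t, ω i = ω' i := fun i hi => h i (by omega)
    rw [expMartExponent, expMartExponent, ih h', playedArm_congr m σ h', memory_congr m σ h',
      h (t + 1) le_rfl]

lemma measurableSet_played_and_pulls_lt (t : ℕ) :
    MeasurableSet {ω : ℕ → Obs | playedArm m σ ω t = a ∧ (memory m σ ω t).pulls a < n} := by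
  obtain ⟨-, hp, -⟩ := measurable_memory m σ (fun ω : ℕ → Obs => ω) measurable_pi_apply t
  exact (measurable_playedArm m σ t (measurableSet_singleton a)).inter
    (hp a measurableSet_Iio)

lemma measurable_expMartExponent (t : ℕ) :
    Measurable fun ω => expMartExponent m σ a n x c ω t := by
  induction t with
  | zero => exact measurable_const
  | succ t ih =>
    refine ih.add (Measurable.ite (measurableSet_played_and_pulls_lt m σ a n t) ?_
      measurable_const)
    exact (((measurable_pi_apply (t + 1)).fst.sub_const c).const_mul x).sub_const _

lemma lintegral_exp_expMartExponent_le {ν : Fin K → Measure ℝ} [∀ a, IsProbabilityMeasure (ν a)]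
    (hν : IsSubGaussian ν) (t : ℕ) :
    ∫⁻ ω, ENNReal.ofReal (Real.exp (expMartExponent m σ a n x (armMean ν a) ω t))
      ∂(law (knownBestMeanStrategy m σ) ν) ≤ 1 := by
  classical
  induction t with
  | zero => simp [expMartExponent]
  | succ t ih =>
    set c := armMean ν a
    have hext : Measurable fun p : Info t × ℝ => extend p.1 :=
      measurable_pi_lambda _ fun i => (measurable_pi_apply _).comp measurable_fst
    let g : Info t → ℝ → ENNReal := fun h y =>
      ENNReal.ofReal (Real.exp (expMartExponent m σ a n x c (extend h) t +
        if playedArm m σ (extend h) t = a ∧ (memory m σ (extend h) t).pulls a < n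
        then x * (y - c) - x ^ 2 / 2 else 0))
    have hg : Measurable (Function.uncurry g) := by
      refine (Real.measurable_exp.comp ?_).ennreal_ofReal
      refine ((measurable_expMartExponent m σ a n x c t).comp hext).add
        (Measurable.ite (hext (measurableSet_played_and_pulls_lt m σ a n t)) ?_ measurable_const)
      fun_prop
    have hgω : ∀ (ω : ℕ → Obs) y, g (Preorder.frestrictLe (π := fun _ => Obs) t ω) y =
        ENNReal.ofReal (Real.exp (expMartExponent m σ a n x c ω t +
          if playedArm m σ ω t = a ∧ (memory m σ ω t).pulls a < n
          then x * (y - c) - x ^ 2 / 2 else 0)) := by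
      intro ω y
      have he := extend_frestrictLe ω t
      simp only [g]
      rw [expMartExponent_congr m σ a n x c he, playedArm_congr m σ he, memory_congr m σ he]
    have hstep := lintegral_law_succ (knownBestMeanStrategy m σ) ν t hg
    simp only [hgω, knownBestMeanStrategy_arm] at hstep
    simp only [expMartExponent]
    rw [hstep]
    refine le_trans (lintegral_mono fun ω => ?_) ih
    dsimp only
    split_ifs with hA
    · simp only [Real.exp_add, ENNReal.ofReal_mul (Real.exp_pos _).le]
      rw [lintegral_const_mul _ (by fun_prop), hA.1]
      exact mul_le_of_le_one_right' (lintegral_exp_increment_le hν a x)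
    · simp

/-- Markov's inequality for the exponential supermartingale. -/
lemma measure_le_expMartExponent_le {ν : Fin K → Measure ℝ} [∀ a, IsProbabilityMeasure (ν a)]
    (hν : IsSubGaussian ν) (t : ℕ) (b : ℝ) :
    (law (knownBestMeanStrategy m σ) ν).real
      {ω | b ≤ expMartExponent m σ a n x (armMean ν a) ω t} ≤ Real.exp (-b) := by
  have h := mul_meas_ge_le_lintegral₀ (μ := law (knownBestMeanStrategy m σ) ν)
    (f := fun ω => ENNReal.ofReal (Real.exp (expMartExponent m σ a n x (armMean ν a) ω t)))
    (measurable_expMartExponent m σ a n x _ t).exp.ennreal_ofReal.aemeasurable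
    (ENNReal.ofReal (Real.exp b))
  have h' := h.trans (lintegral_exp_expMartExponent_le m σ a n x hν t)
  have hset : {ω | ENNReal.ofReal (Real.exp b) ≤
      ENNReal.ofReal (Real.exp (expMartExponent m σ a n x (armMean ν a) ω t))} =
      {ω | b ≤ expMartExponent m σ a n x (armMean ν a) ω t} := by
    ext ω
    simp [ENNReal.ofReal_le_ofReal_iff (Real.exp_pos _).le]
  rw [hset] at h'
  have h2 := ENNReal.toReal_mono ENNReal.one_ne_top h'
  rw [ENNReal.toReal_mul, ENNReal.toReal_ofReal (Real.exp_pos _).le, ENNReal.toReal_one] at h2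
  rw [Real.exp_neg, ← one_div, le_div_iff₀' (Real.exp_pos _)]
  exact h2

lemma memory_pulls_succ (ω : ℕ → Obs) (t : ℕ) : (memory m σ ω (t + 1)).pulls a =
    (memory m σ ω t).pulls a + if playedArm m σ ω t = a then 1 else 0 := by
  classical
  simp only [memory, updateMemory, playedArm]
  congr

lemma memory_total_succ (ω : ℕ → Obs) (t : ℕ) : (memory m σ ω (t + 1)).total a =
    (memory m σ ω t).total a + if playedArm m σ ω t = a then (ω (t + 1)).1 else 0 := by
  classical
  simp only [memory, updateMemory, playedArm]
  congr

lemma expMartExponent_of_pulls_le {ω : ℕ → Obs} {t : ℕ} (h : (memory m σ ω t).pulls a ≤ n) :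
    expMartExponent m σ a n x c ω t =
      x * ((memory m σ ω t).total a - (memory m σ ω t).pulls a * c)
        - (memory m σ ω t).pulls a * (x ^ 2 / 2) := by
  induction t with
  | zero => simp [expMartExponent, memory, initialMemory]
  | succ t ih =>
    rw [memory_pulls_succ] at h ⊢
    rw [memory_total_succ, expMartExponent, ih (by omega)]
    by_cases hA : playedArm m σ ω t = a
    · have hlt : (memory m σ ω t).pulls a < n := by simpa [hA] using h
      simp only [hA, hlt, and_self, if_true]
      push_cast
      ring
    · simp [hA]

lemma expMartExponent_eq_of_le_pulls {ω : ℕ → Obs} {t s : ℕ} (hts : t ≤ s)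
    (h : n ≤ (memory m σ ω t).pulls a) :
    n ≤ (memory m σ ω s).pulls a ∧
      expMartExponent m σ a n x c ω s = expMartExponent m σ a n x c ω t := by
  induction s, hts using Nat.le_induction with
  | base => exact ⟨h, rfl⟩
  | succ s _ ih =>
    refine ⟨ih.1.trans (by rw [memory_pulls_succ]; exact Nat.le_add_right _ _), ?_⟩
    rw [expMartExponent, ih.2, if_neg fun h => absurd h.2 (not_lt.2 ih.1), add_zero]

/-- At any time after the `n`-th play of arm `a`, the exponent is a function of the sum of the
first `n` rewards of that arm. -/
lemma expMartExponent_eq {ω : ℕ → Obs} {t T : ℕ} (htT : t ≤ T) :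
    expMartExponent m σ a ((memory m σ ω t).pulls a) x c ω T =
      x * ((memory m σ ω t).total a - (memory m σ ω t).pulls a * c)
        - (memory m σ ω t).pulls a * (x ^ 2 / 2) := by
  rw [(expMartExponent_eq_of_le_pulls m σ a _ x c htT le_rfl).2,
    expMartExponent_of_pulls_le m σ a _ x c le_rfl]

end Concentration

/-! ### Counting the plays of an arm along a trajectory -/

section Counting

variable {K : ℕ} [NeZero K] (m : ℝ) (σ : SelectionRule K)

lemma memory_next_succ (ω : ℕ → Obs) (t : ℕ) :
    (memory m σ ω (t + 1)).next = nextPosition m (memory m σ ω t) := rfl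

lemma pulls_le (ω : ℕ → Obs) (a : Fin K) (t : ℕ) : (memory m σ ω t).pulls a ≤ t := by
  induction t with
  | zero => simp [memory, initialMemory]
  | succ t ih => rw [memory_pulls_succ]; split_ifs <;> omega

/-- Deterministic count of the plays of arm `a`, relative to another arm `b`. At each time,
`1 ≤ e n` if `b`, played `n ≥ 1` times so far, is not a candidate, and `1 ≤ f n` if `a`, played
`n ≥ 1` times so far, is one. The play of `a` in the first pass is counted
by the first term, the passes started later by the sum of `e`: one such pass can start for each
value of the number of plays of `b`, since `b` is played in it. The plays of `a` as a
candidate are counted by the sum of `f`. The two indicators say whether the pass in progress has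
already reached `a`, and whether it has still to reach `b`; they make the bound inductive in the
middle of a pass. -/
lemma pulls_le_of_weights (ω : ℕ → Obs) (T : ℕ) (a b : Fin K) (e f : ℕ → ℝ)
    (he0 : ∀ n, 0 ≤ e n) (hf0 : ∀ n, 0 ≤ f n)
    (he : ∀ t < T, 1 ≤ (memory m σ ω t).pulls b → b ∉ candidates m (memory m σ ω t) →
      1 ≤ e ((memory m σ ω t).pulls b))
    (hf : ∀ t < T, 1 ≤ (memory m σ ω t).pulls a → a ∈ candidates m (memory m σ ω t) →
      1 ≤ f ((memory m σ ω t).pulls a)) (t : ℕ) (htT : t ≤ T) :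
    (memory m σ ω t).next ≤ K ∧
    (∀ c : Fin K, (c : ℕ) < (memory m σ ω t).next → 1 ≤ (memory m σ ω t).pulls c) ∧
    ((memory m σ ω t).pulls a : ℝ) ≤ (if (a : ℕ) < (memory m σ ω t).next then 1 else 0) +
      ∑ n ∈ Ico 1 ((memory m σ ω t).pulls b + if (memory m σ ω t).next ≤ b then 1 else 0), e n +
      ∑ n ∈ Ico 1 ((memory m σ ω t).pulls a), f n := by
  classical
  induction t with
  | zero => simp [memory, initialMemory]
  | succ t ih =>
    obtain ⟨hK, hpos, hle⟩ := ih (by omega)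
    have he' := he t (by omega)
    have hf' := hf t (by omega)
    rw [memory_next_succ]
    simp only [memory_pulls_succ]
    set s := memory m σ ω t
    have hA : playedArm m σ ω t = chooseArm m σ s (ω t).2 := rfl
    rw [hA]
    have hemono : ∀ {i j : ℕ}, i ≤ j → ∑ n ∈ Ico 1 i, e n ≤ ∑ n ∈ Ico 1 j, e n := fun h =>
      Finset.sum_le_sum_of_subset_of_nonneg (Finset.Ico_subset_Ico_right h) fun n _ _ => he0 n
    have hfmono : ∀ {i j : ℕ}, i ≤ j → ∑ n ∈ Ico 1 i, f n ≤ ∑ n ∈ Ico 1 j, f n := fun h =>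
      Finset.sum_le_sum_of_subset_of_nonneg (Finset.Ico_subset_Ico_right h) fun n _ _ => hf0 n
    by_cases h1 : s.next < K
    · -- a pass is in progress
      have hn : nextPosition m s = s.next + 1 := by simp [nextPosition, h1]
      have hc : chooseArm m σ s (ω t).2 = ⟨s.next, h1⟩ := by simp [chooseArm, h1]
      rw [hn, hc]
      have hiff : ∀ c : Fin K, (⟨s.next, h1⟩ : Fin K) = c ↔ s.next = c := fun c => Fin.ext_iff
      simp only [hiff]
      refine ⟨h1, fun c hcl => ?_, ?_⟩
      · rcases Nat.lt_succ_iff_lt_or_eq.1 hcl with h | h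
        · exact (hpos c h).trans (Nat.le_add_right _ _)
        · simp [h.symm]
      · have hb : s.pulls b + (if s.next ≤ b then 1 else 0) =
            (s.pulls b + if s.next = b then 1 else 0) + if s.next + 1 ≤ b then 1 else 0 := by
          split_ifs <;> omega
        rw [← hb]
        have hfm := hfmono (Nat.le_add_right (s.pulls a) (if s.next = (a : ℕ) then 1 else 0))
        have hind : (if (a : ℕ) < s.next + 1 then (1 : ℝ) else 0) =
            (if (a : ℕ) < s.next then 1 else 0) + if s.next = (a : ℕ) then 1 else 0 := by
          split_ifs <;> first | omega | norm_num
        rw [hind]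
        push_cast
        linarith
    · have hsK : s.next = K := le_antisymm hK (not_lt.1 h1)
      have hpos' : ∀ c, 1 ≤ s.pulls c := fun c => hpos c (by rw [hsK]; exact c.2)
      have hKb : ¬ K ≤ (b : ℕ) := not_le.2 b.2
      simp only [hsK, a.2, hKb, if_true, if_false, add_zero] at hle
      by_cases h2 : (candidates m s).Nonempty
      · -- a candidate is played
        have hn : nextPosition m s = K := by simp [nextPosition, h1, h2]
        have hc : chooseArm m σ s (ω t).2 ∈ candidates m s := by
          simpa [chooseArm, h1, h2] using σ.pick_mem _ h2 _
        rw [hn]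
        simp only [a.2, hKb, if_true, if_false, add_zero]
        refine ⟨le_rfl, fun c _ => (hpos' c).trans (Nat.le_add_right _ _), ?_⟩
        have hem := hemono
          (Nat.le_add_right (s.pulls b) (if chooseArm m σ s (ω t).2 = b then 1 else 0))
        by_cases hca : chooseArm m σ s (ω t).2 = a
        · simp only [hca, if_true]
          rw [Finset.sum_Ico_succ_top (hpos' a)]
          have := hf' (hpos' a) (hca ▸ hc)
          rw [hca] at hem
          push_cast
          linarith
        · simp only [hca, if_false, add_zero]
          linarith
      · -- a new pass starts with arm `0`
        have hn : nextPosition m s = 1 := by simp [nextPosition, h1, h2]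
        have hc : chooseArm m σ s (ω t).2 = 0 := by simp [chooseArm, h1, h2]
        rw [hn, hc]
        refine ⟨Nat.one_le_iff_ne_zero.2 (NeZero.ne K),
          fun c _ => (hpos' c).trans (Nat.le_add_right _ _), ?_⟩
        have hz : ∀ c : Fin K, (0 : Fin K) = c ↔ (c : ℕ) = 0 := fun c => by
          rw [Fin.ext_iff, Fin.val_zero, eq_comm]
        simp only [hz]
        have hb : (s.pulls b + if (b : ℕ) = 0 then 1 else 0) + (if 1 ≤ (b : ℕ) then 1 else 0) =
            s.pulls b + 1 := by
          split_ifs <;> omega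
        rw [hb, Finset.sum_Ico_succ_top (hpos' b)]
        have := he' (hpos' b) fun h => h2 ⟨b, h⟩
        have hfm := hfmono (Nat.le_add_right (s.pulls a) (if (a : ℕ) = 0 then 1 else 0))
        have hind : (if (a : ℕ) < 1 then (1 : ℝ) else 0) = if (a : ℕ) = 0 then 1 else 0 := by
          simp
        rw [hind]
        push_cast
        linarith

/-- The bound of `pulls_le_of_weights` at the horizon `T`. -/
lemma pulls_le_one_add_sum (ω : ℕ → Obs) (T : ℕ) (a b : Fin K) (e f : ℕ → ℝ)
    (he0 : ∀ n, 0 ≤ e n) (hf0 : ∀ n, 0 ≤ f n)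
    (he : ∀ t < T, 1 ≤ (memory m σ ω t).pulls b → b ∉ candidates m (memory m σ ω t) →
      1 ≤ e ((memory m σ ω t).pulls b))
    (hf : ∀ t < T, 1 ≤ (memory m σ ω t).pulls a → a ∈ candidates m (memory m σ ω t) →
      1 ≤ f ((memory m σ ω t).pulls a)) :
    ((memory m σ ω T).pulls a : ℝ) ≤ 1 + ∑ n ∈ Ico 1 (T + 1), e n + ∑ n ∈ Ico 1 (T + 1), f n := by
  have h := (pulls_le_of_weights m σ ω T a b e f he0 hf0 he hf T le_rfl).2.2
  have ha := pulls_le m σ ω a T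
  have hb := pulls_le m σ ω b T
  refine h.trans (add_le_add_three ?_ ?_ ?_)
  · split_ifs <;> norm_num
  · refine Finset.sum_le_sum_of_subset_of_nonneg (Finset.Ico_subset_Ico_right ?_) fun n _ _ => he0 n
    split_ifs <;> omega
  · exact Finset.sum_le_sum_of_subset_of_nonneg (Finset.Ico_subset_Ico_right (by omega))
      fun n _ _ => hf0 n

end Counting

/-! ### Numerical estimates -/

section Estimates

/-- A number of plays beyond which `√(4 ln n / n) ≤ d / 2`; it is negative for large `d`. -/
noncomputable def burnIn (d : ℝ) : ℝ := 18 / d ^ 2 * (Real.log (144 / d ^ 2) - 1)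

lemma sqrt_le_half_of_burnIn_lt {d : ℝ} (hd : 0 < d) {n : ℕ} (hn : 1 ≤ n)
    (h : burnIn d < n) : Real.sqrt (4 * Real.log n / n) ≤ d / 2 := by
  have hn0 : (0 : ℝ) < n := by exact_mod_cast hn
  have hd2 : 0 < d ^ 2 := by positivity
  -- the tangent of `log` at `144 / d ^ 2`
  have hlog : Real.log n ≤ n * d ^ 2 / 144 - 1 + Real.log (144 / d ^ 2) := by
    have h1 := Real.log_le_sub_one_of_pos (x := n / (144 / d ^ 2)) (by positivity)
    rw [Real.log_div hn0.ne' (by positivity)] at h1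
    have h2 : (n : ℝ) / (144 / d ^ 2) = n * d ^ 2 / 144 := by field_simp
    linarith
  have h3 : 18 * (Real.log (144 / d ^ 2) - 1) < n * d ^ 2 := by
    unfold burnIn at h
    rwa [div_mul_eq_mul_div, div_lt_iff₀ hd2] at h
  rw [Real.sqrt_le_iff]
  refine ⟨by positivity, ?_⟩
  rw [div_le_iff₀ hn0]
  nlinarith

lemma sum_exp_neg_le {r : ℝ} (hr : 0 < r) (s : Finset ℕ) (hs : ∀ n ∈ s, 1 ≤ n) :
    ∑ n ∈ s, Real.exp (-(n * r)) ≤ 1 / r := by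
  have hq : Real.exp (-r) < 1 := by simpa using hr
  have hg := (hasSum_geometric_of_lt_one (Real.exp_pos (-r)).le hq)
  have h1 : ∑ n ∈ insert 0 s, Real.exp (-r) ^ n ≤ (1 - Real.exp (-r))⁻¹ :=
    sum_le_hasSum _ (fun n _ => by positivity) hg
  rw [Finset.sum_insert (fun h => by simpa using hs 0 h)] at h1
  have h2 : ∀ n : ℕ, Real.exp (-(n * r)) = Real.exp (-r) ^ n := fun n => by
    rw [← Real.exp_nat_mul]; ring_nf
  simp only [h2]
  have h3 : Real.exp (-r) * (1 + r) ≤ 1 := by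
    calc _ ≤ Real.exp (-r) * Real.exp r := by
          gcongr
          linarith [Real.add_one_le_exp r]
      _ = 1 := by rw [← Real.exp_add]; simp
  have h4 : (1 - Real.exp (-r))⁻¹ ≤ 1 + 1 / r := by
    rw [inv_le_comm₀ (by linarith) (by positivity)]
    rw [show (1 + 1 / r)⁻¹ = r / (1 + r) by field_simp; ring, div_le_iff₀ (by positivity)]
    linarith
  rw [pow_zero] at h1
  linarith

lemma card_filter_le_max (T : ℕ) (B : ℝ) :
    ((#((Ico 1 T).filter fun n : ℕ => (n : ℝ) ≤ B) : ℕ) : ℝ) ≤ max B 0 := by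
  have hsub : ((Ico 1 T).filter fun n : ℕ => (n : ℝ) ≤ B) ⊆ Ioc 0 ⌊B⌋₊ := by
    intro n hn
    simp only [Finset.mem_filter, Finset.mem_Ico, Finset.mem_Ioc] at hn ⊢
    exact ⟨by omega, Nat.le_floor hn.2⟩
  have h1 : ((#((Ico 1 T).filter fun n : ℕ => (n : ℝ) ≤ B) : ℕ) : ℝ) ≤ ⌊B⌋₊ := by
    exact_mod_cast (Finset.card_le_card hsub).trans (by simp)
  rcases le_total 0 B with h | h
  · exact h1.trans ((Nat.floor_le h).trans (le_max_left _ _))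
  · rw [Nat.floor_of_nonpos h] at h1
    exact h1.trans (by simp)

lemma sum_inv_sq_le (T : ℕ) : ∑ n ∈ Ico 1 T, 1 / (n : ℝ) ^ 2 ≤ 1.7 := by
  refine (sum_le_hasSum _ (fun n _ => by positivity) hasSum_zeta_two).trans ?_
  have := Real.pi_lt_d2
  have := Real.pi_pos
  nlinarith

lemma burnIn_add_tail_le {d : ℝ} (hd : 0 < d) :
    1 + 1.7 + (max (burnIn d) 0 + 1 / (d ^ 2 / 8)) ≤ 36 * Real.log (17 / d) / d ^ 2 + 3 := by
  have hd2 : 0 < d ^ 2 := by positivity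
  have hl144 : Real.log (144 / d ^ 2) = 2 * Real.log (12 / d) := by
    rw [show (144 : ℝ) / d ^ 2 = (12 / d) ^ 2 by rw [div_pow]; norm_num, Real.log_pow]
    norm_num
  have hl17 : Real.log (12 / d) ≤ Real.log (17 / d) := by gcongr; norm_num
  rcases le_total (burnIn d) 0 with h | h
  · rw [max_eq_right h]
    have h1 := Real.one_sub_inv_le_log_of_pos (x := 17 / d) (by positivity)
    rw [inv_div] at h1
    -- `36 (1 - d / 17) + 0.3 d² - 8` has a negative discriminant
    have : 8 ≤ 36 * Real.log (17 / d) + 0.3 * d ^ 2 := by nlinarith [sq_nonneg (d - 3.53)]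
    have h2 : 8 / d ^ 2 ≤ (36 * Real.log (17 / d) + 0.3 * d ^ 2) / d ^ 2 := by gcongr
    rw [add_div, mul_div_assoc 0.3, div_self hd2.ne'] at h2
    rw [one_div_div]
    linarith
  · rw [max_eq_left h]
    unfold burnIn
    rw [hl144, one_div_div]
    have h2 : (18 * (2 * Real.log (12 / d) - 1) + 8) / d ^ 2 ≤
        36 * Real.log (17 / d) / d ^ 2 := by
      gcongr
      linarith
    rw [add_div] at h2
    rw [div_mul_eq_mul_div]
    linarith

end Estimates

/-! ### The expected number of plays of a suboptimal arm -/

section Plays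

variable {K : ℕ} [NeZero K] (ν : Fin K → Measure ℝ) (σ : SelectionRule K)

lemma gap_nonneg (a : Fin K) : 0 ≤ gap ν a :=
  sub_nonneg.2 (Finset.le_sup' (armMean ν) (Finset.mem_univ a))

lemma sum_gap_playedArm (m : ℝ) (ω : ℕ → Obs) (T : ℕ) :
    ∑ t ∈ range T, gap ν (playedArm m σ ω t) =
      ∑ a, gap ν a * ((memory m σ ω T).pulls a : ℝ) := by
  classical
  induction T with
  | zero => simp [memory, initialMemory]
  | succ T ih =>
    rw [Finset.sum_range_succ, ih]
    simp only [memory_pulls_succ]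
    push_cast
    simp [mul_add, Finset.sum_add_distrib]

omit [NeZero K] in
lemma mem_candidates {m : ℝ} {s : Memory K} {a : Fin K} : a ∈ candidates m s ↔
    -Real.sqrt (4 * Real.log (s.pulls a) / s.pulls a) < empMean s a - m := by
  simp [candidates]

/-- A candidate of expectation `m - d` that has been played more than `burnIn d` times has an
empirical mean exceeding this expectation by at least `d / 2`, which makes the exponent large. -/
lemma le_expMartExponent_of_mem_candidates {m d : ℝ} (hd : 0 < d) {ω : ℕ → Obs} {t T : ℕ}
    (htT : t ≤ T) {a : Fin K} (ha : a ∈ candidates m (memory m σ ω t))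
    (hn : 1 ≤ (memory m σ ω t).pulls a) (hB : burnIn d < (memory m σ ω t).pulls a) :
    ((memory m σ ω t).pulls a : ℝ) * (d ^ 2 / 8) ≤
      expMartExponent m σ a ((memory m σ ω t).pulls a) (d / 2) (m - d) ω T := by
  rw [expMartExponent_eq m σ a _ _ htT]
  have hs := sqrt_le_half_of_burnIn_lt hd hn hB
  rw [mem_candidates, empMean] at ha
  generalize (memory m σ ω t).total a = S at *
  generalize (memory m σ ω t).pulls a = n at *
  have hn0 : (0 : ℝ) < n := by exact_mod_cast hn
  have h1 : m - d / 2 ≤ S / n := by linarith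
  rw [le_div_iff₀ hn0] at h1
  nlinarith

/-- If an arm of expectation `m` is not a candidate, its empirical mean is so far below `m` that
the exponent is large. -/
lemma le_expMartExponent_of_notMem_candidates {m : ℝ} {ω : ℕ → Obs} {t T : ℕ}
    (htT : t ≤ T) {b : Fin K} (hb : b ∉ candidates m (memory m σ ω t))
    (hn : 1 ≤ (memory m σ ω t).pulls b) :
    2 * Real.log ((memory m σ ω t).pulls b) ≤
      expMartExponent m σ b ((memory m σ ω t).pulls b)
        (-Real.sqrt (4 * Real.log ((memory m σ ω t).pulls b) / (memory m σ ω t).pulls b)) m ω T := by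
  rw [expMartExponent_eq m σ b _ _ htT]
  rw [mem_candidates, empMean, not_lt] at hb
  generalize (memory m σ ω t).total b = S at *
  generalize (memory m σ ω t).pulls b = n at *
  have hn0 : (0 : ℝ) < n := by exact_mod_cast hn
  have hlog : 0 ≤ Real.log n := Real.log_nonneg (by exact_mod_cast hn)
  have hsq := Real.sq_sqrt (x := 4 * Real.log n / n) (by positivity)
  have hr := Real.sqrt_nonneg (4 * Real.log n / n)
  generalize Real.sqrt (4 * Real.log n / n) = r at *
  have h1 : S / n ≤ m - r := by linarith
  rw [div_le_iff₀ hn0] at h1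
  have h2 : n * r ^ 2 = 4 * Real.log n := by rw [hsq]; field_simp
  nlinarith

lemma integral_pulls_le [∀ a, IsProbabilityMeasure (ν a)] (hν : IsSubGaussian ν)
    (a : Fin K) (ha : 0 < gap ν a) (T : ℕ) :
    ∫ ω, ((memory (bestMean ν) σ ω T).pulls a : ℝ)
        ∂(law (knownBestMeanStrategy (bestMean ν) σ) ν) ≤
      36 * Real.log (17 / gap ν a) / gap ν a ^ 2 + 3 := by
  classical
  obtain ⟨b, -, hb⟩ := Finset.exists_mem_eq_sup' Finset.univ_nonempty (armMean ν)
  have hbm : armMean ν b = bestMean ν := hb.symm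
  set m := bestMean ν
  set d := gap ν a with hd
  have ham : armMean ν a = m - d := by rw [hd, gap]; ring
  set P := law (knownBestMeanStrategy m σ) ν
  -- For `n ≥ 1`, `E n` and `F n` contain the events that, at some time up to `T`, the arm `b`
  -- (resp. `a`) has been played `n` times and is not (resp. is) a candidate.
  let E : ℕ → Set (ℕ → Obs) := fun n =>
    {ω | 2 * Real.log n ≤ expMartExponent m σ b n (-Real.sqrt (4 * Real.log n / n)) m ω T}
  let F : ℕ → Set (ℕ → Obs) := fun n =>
    if (n : ℝ) ≤ burnIn d then Set.univ
    else {ω | (n : ℝ) * (d ^ 2 / 8) ≤ expMartExponent m σ a n (d / 2) (m - d) ω T}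
  have hEm : ∀ n, MeasurableSet (E n) := fun n =>
    measurableSet_le measurable_const (measurable_expMartExponent m σ b n _ _ T)
  have hFm : ∀ n, MeasurableSet (F n) := fun n => by
    simp only [F]
    split_ifs
    · exact .univ
    · exact measurableSet_le measurable_const (measurable_expMartExponent m σ a n _ _ T)
  have hEint : ∀ n, Integrable ((E n).indicator fun _ => (1 : ℝ)) P := fun n =>
    (integrable_const 1).indicator (hEm n)
  have hFint : ∀ n, Integrable ((F n).indicator fun _ => (1 : ℝ)) P := fun n =>
    (integrable_const 1).indicator (hFm n)
  have hEtot : Integrable (fun ω => ∑ n ∈ Ico 1 (T + 1), (E n).indicator (fun _ => (1 : ℝ)) ω) P :=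
    integrable_finsetSum _ fun n _ => hEint n
  have hFtot : Integrable (fun ω => ∑ n ∈ Ico 1 (T + 1), (F n).indicator (fun _ => (1 : ℝ)) ω) P :=
    integrable_finsetSum _ fun n _ => hFint n
  have hE1 : Integrable
      (fun ω => 1 + ∑ n ∈ Ico 1 (T + 1), (E n).indicator (fun _ => (1 : ℝ)) ω) P :=
    (integrable_const 1).add hEtot
  have hpt : ∀ ω, ((memory m σ ω T).pulls a : ℝ) ≤
      1 + ∑ n ∈ Ico 1 (T + 1), (E n).indicator (fun _ => (1 : ℝ)) ω +
        ∑ n ∈ Ico 1 (T + 1), (F n).indicator (fun _ => (1 : ℝ)) ω := by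
    intro ω
    refine pulls_le_one_add_sum m σ ω T a b (fun n => (E n).indicator (fun _ => (1 : ℝ)) ω)
      (fun n => (F n).indicator (fun _ => (1 : ℝ)) ω)
      (fun n => Set.indicator_nonneg (fun _ _ => zero_le_one) _)
      (fun n => Set.indicator_nonneg (fun _ _ => zero_le_one) _) ?_ ?_
    · intro t ht hn hc
      have : ω ∈ E ((memory m σ ω t).pulls b) :=
        le_expMartExponent_of_notMem_candidates σ ht.le hc hn
      simp [this]
    · intro t ht hn hc
      have : ω ∈ F ((memory m σ ω t).pulls a) := by
        simp only [F]
        split_ifs with h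
        · trivial
        · exact le_expMartExponent_of_mem_candidates σ ha ht.le hc hn (not_le.1 h)
      simp [this]
  have hEP : ∀ n ∈ Ico 1 (T + 1), P.real (E n) ≤ 1 / (n : ℝ) ^ 2 := by
    intro n hn
    have hn0 : (0 : ℝ) < n := by exact_mod_cast (Finset.mem_Ico.1 hn).1
    have h := measure_le_expMartExponent_le m σ b n (-Real.sqrt (4 * Real.log n / n)) hν T
      (2 * Real.log n)
    rw [hbm] at h
    refine h.trans (le_of_eq ?_)
    rw [Real.exp_neg, mul_comm, Real.exp_mul, Real.exp_log hn0]
    norm_num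
  have hFP : ∀ n, P.real (F n) ≤
      if (n : ℝ) ≤ burnIn d then 1 else Real.exp (-(n * (d ^ 2 / 8))) := by
    intro n
    simp only [F]
    split_ifs with h
    · exact measureReal_le_one
    · have h := measure_le_expMartExponent_le m σ a n (d / 2) hν T (n * (d ^ 2 / 8))
      rwa [ham] at h
  have hFsum : ∑ n ∈ Ico 1 (T + 1), P.real (F n) ≤ max (burnIn d) 0 + 1 / (d ^ 2 / 8) := by
    refine (Finset.sum_le_sum fun n _ => hFP n).trans ?_
    rw [Finset.sum_ite]
    refine add_le_add ?_ (sum_exp_neg_le (by positivity) _ fun n hn => ?_)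
    · simpa using card_filter_le_max (T + 1) (burnIn d)
    · exact (Finset.mem_Ico.1 (Finset.mem_filter.1 hn).1).1
  calc ∫ ω, ((memory m σ ω T).pulls a : ℝ) ∂P
      ≤ ∫ ω, (1 + ∑ n ∈ Ico 1 (T + 1), (E n).indicator (fun _ => (1 : ℝ)) ω +
        ∑ n ∈ Ico 1 (T + 1), (F n).indicator (fun _ => (1 : ℝ)) ω) ∂P := by
        refine integral_mono_of_nonneg (.of_forall fun ω => Nat.cast_nonneg _)
          (hE1.add hFtot) (.of_forall hpt)
    _ = 1 + ∑ n ∈ Ico 1 (T + 1), P.real (E n) + ∑ n ∈ Ico 1 (T + 1), P.real (F n) := by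
        rw [integral_add hE1 hFtot, integral_add (integrable_const 1) hEtot,
          integral_finsetSum _ fun n _ => hEint n, integral_finsetSum _ fun n _ => hFint n]
        simp [hEm, hFm, integral_indicator_const]
    _ ≤ 1 + 1.7 + (max (burnIn d) 0 + 1 / (d ^ 2 / 8)) := by
        have := (Finset.sum_le_sum hEP).trans (sum_inv_sq_le (T + 1))
        linarith
    _ ≤ _ := burnIn_add_tail_le ha

end Plays

end Bandit

theorem mainTheorem10 (K : ℕ) [NeZero K] (ν : Fin K → Measure ℝ)
    [∀ a, IsProbabilityMeasure (ν a)] (hν : Bandit.IsSubGaussian ν)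
    (σ : Bandit.SelectionRule K) (T : ℕ) :
    Bandit.regret (Bandit.knownBestMeanStrategy (Bandit.bestMean ν) σ) ν T ≤
      ∑ a with 0 < Bandit.gap ν a,
        (36 * Real.log (17 / Bandit.gap ν a) / Bandit.gap ν a + 3 * Bandit.gap ν a) := by
  open Bandit in
  set m := bestMean ν
  have hpint : ∀ a, Integrable (fun ω => ((memory m σ ω T).pulls a : ℝ))
      (law (knownBestMeanStrategy m σ) ν) := by
    intro a
    obtain ⟨-, hp, -⟩ := measurable_memory m σ (fun ω : ℕ → Obs => ω) measurable_pi_apply T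
    refine Integrable.of_bound (C := T) (Measurable.aestronglyMeasurable ?_)
      (.of_forall fun ω => ?_)
    · exact (measurable_of_countable (fun n : ℕ => (n : ℝ))).comp (hp a)
    · simpa using pulls_le m σ ω a T
  have hgint : ∀ t, Integrable (fun ω => gap ν (playedArm m σ ω t))
      (law (knownBestMeanStrategy m σ) ν) := by
    intro t
    obtain ⟨C, hC⟩ := (Set.finite_range (gap ν)).isBounded.exists_norm_le
    exact Integrable.of_bound (C := C) (((measurable_of_countable (gap ν)).comp
      (measurable_playedArm m σ t)).aestronglyMeasurable) (.of_forall fun ω => hC _ ⟨_, rfl⟩)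
  rw [regret_eq_sum_gap hν]
  simp only [knownBestMeanStrategy_arm]
  rw [← integral_finsetSum _ fun t _ => hgint t]
  simp only [sum_gap_playedArm]
  rw [integral_finsetSum _ fun a _ => (hpint a).const_mul _]
  simp only [integral_const_mul]
  rw [Finset.sum_filter]
  refine Finset.sum_le_sum fun a _ => ?_
  split_ifs with ha
  · calc _ ≤ gap ν a * (36 * Real.log (17 / gap ν a) / gap ν a ^ 2 + 3) := by
          gcongr
          exact integral_pulls_le ν σ hν a ha T
      _ = _ := by field_simp
  · rw [le_antisymm (not_lt.1 ha) (gap_nonneg ν a), zero_mul]
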